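/- Let $\Gamma_1,\Gamma_2,\Gamma_3,\Gamma_4$ be nonzero real numbers (the vorticities) with $\Gamma_1+\Gamma_2+\Gamma_3+\Gamma_4=0$. A (complex) normalized central configuration of the four-vortex problem is a point $$\mathcal Q=\big((z_n)_{1\le n\le 4},(Z_{jk})_{1\le j<k\le 4},(w_n)_{1\le n\le 4},(W_{jk})_{1\le j<k\le 4}\big)\in(\mathbb C^4\times\mathbb C^6)^2$$ for which there is $\Lambda\in\mathbb C$ with $|\Lambda|=1$ such that, writing $z_{jk}=z_k-z_j$, $w_{jk}=w_k-w_j$ and $Z_{kj}=-Z_{jk}$, $W_{kj}=-W_{jk}$ for $j<k$, $$\Lambda z_n=\sum_{j\ne n}\Gamma_j Z_{jn},\qquad \Lambda^{-1} w_n=\sum_{j\ne n}\Gamma_j W_{jn}\qquad(1\le n\le 4),$$ $$Z_{jk}w_{jk}=1,\qquad W_{jk}z_{jk}=1\qquad(1\le j<k\le 4),\qquad z_{12}=w_{12}.$$ Then there are only finitely many normalized central configurations: the set of all such points $\mathcal Q$ (over all $\Lambda$ with $|\Lambda|=1$ together) is finite. -/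

import Mathlib

/-!
Central configurations of the planar four-vortex problem in the complex domain.
The vortices `1, 2, 3, 4` are indexed by `Fin 4`.
-/

namespace FourVortex

/-- Index set of the six pairs `j < k`. -/
abbrev Pair : Type := {p : Fin 4 × Fin 4 // p.1 < p.2}

/-- The variables `(z₁, …, z₄, Z₁₂, Z₁₃, …, Z₃₄)` (or the same with `w`, `W`). -/
abbrev HalfSpace : Type := (Fin 4 → ℂ) × (Pair → ℂ)

/-- The space `(ℂ⁴ × ℂ⁶)²` of all points `𝒬 = (𝒵, 𝒲)`. -/
abbrev Space : Type := HalfSpace × HalfSpace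

/-- The difference `z_{jk} = z_k - z_j`. -/
def sep (z : Fin 4 → ℂ) (j k : Fin 4) : ℂ := z k - z j

/-- The antisymmetric extension `Z_{kj} = -Z_{jk}` of a family given for `j < k`
(the value for `j = k` is irrelevant and set to `0`). -/
def ext (Z : Pair → ℂ) (j k : Fin 4) : ℂ :=
  if h : j < k then Z ⟨(j, k), h⟩ else if h : k < j then -Z ⟨(k, j), h⟩ else 0

/-- The polynomial system for `𝒬 = ((z, Z), (w, W))`, with vorticities `Γ` and multiplier `Λ`. -/
structure IsSolution (Γ : Fin 4 → ℝ) (Λ : ℂ) (Q : Space) : Prop where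
  z_eq : ∀ n, Λ * Q.1.1 n = ∑ j ∈ Finset.univ.erase n, (Γ j : ℂ) * ext Q.1.2 j n
  w_eq : ∀ n, Λ⁻¹ * Q.2.1 n = ∑ j ∈ Finset.univ.erase n, (Γ j : ℂ) * ext Q.2.2 j n
  Z_mul : ∀ j k, j < k → ext Q.1.2 j k * sep Q.2.1 j k = 1
  W_mul : ∀ j k, j < k → ext Q.2.2 j k * sep Q.1.1 j k = 1
  rotation : sep Q.1.1 0 1 = sep Q.2.1 0 1

/-- `𝒬` is a (complex) normalized central configuration for the vorticities `Γ`: it solves the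
system for some `Λ` on the unit circle (so that `Λ⁻¹` is the complex conjugate of `Λ`). -/
def IsNormalizedCentralConfiguration (Γ : Fin 4 → ℝ) (Q : Space) : Prop :=
  ∃ Λ : ℂ, ‖Λ‖ = 1 ∧ IsSolution Γ Λ Q

end FourVortex

/-! Antisymmetry of the interaction makes the first moments of `z` and `w` vanish. As the total
vorticity is zero, this condition is translation invariant, so up to translation and scale each half
is determined by one ratio: x = z₁₃/z₁₂, y = w₁₃/w₁₂. The equations for `z` give x = φ(y) and those
for `w` give y = φ(x), with φ = `relVelocity₃` / `relVelocity₂`.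

So y is fixed by φ ∘ φ. If φ has degree d ≥ 2, then φ ∘ φ has degree d² > 1 and is not the identity,
which leaves finitely many ratios (`Polynomial.finite_two_cycles`). The degree is the number of
distinct poles, at least two, because numerator and denominator share no zero: see
`residues_ne_zero` at the poles, `relVelocity_ne_zero` elsewhere, and `finite_ratios` at infinity.

With a = z₁₂ = w₁₂, `relVelocity₂` is Λa² at y and Λ⁻¹a² at x. Hence x and y determine a⁴, then a
determines Λ, and these data determine `𝒬` (`IsSolution.unique`). -/

/-! ### Two-cycles of rational maps -/

open Polynomial in
/-- A rational map `p / q` of degree `d ≥ 2` has only finitely many points of period two. -/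
theorem Polynomial.finite_two_cycles {p q : ℂ[X]} {d : ℕ} (hd : 2 ≤ d)
    (hp : p.natDegree ≤ d) (hq : q.natDegree ≤ d)
    (hlead : p.coeff d ≠ 0 ∨ q.coeff d ≠ 0) (hroot : ∀ y, p.eval y ≠ 0 ∨ q.eval y ≠ 0) :
    {y : ℂ | ∃ x, x * q.eval y = p.eval y ∧ y * q.eval x = p.eval x}.Finite := by
  -- `H r` is the degree `d` homogenization of `r`, so `P p / P q` is the second iterate of `p / q`.
  let H (r : ℂ[X]) (u v : ℂ) : ℂ := ∑ i ∈ Finset.range (d + 1), r.coeff i * u ^ i * v ^ (d - i)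
  let P (r : ℂ[X]) : ℂ[X] := ∑ i ∈ Finset.range (d + 1), C (r.coeff i) * (p ^ i * q ^ (d - i))
  have hH (r : ℂ[X]) (hr : r.natDegree ≤ d) (u v : ℂ) (hv : v ≠ 0) :
      H r u v = v ^ d * r.eval (u / v) := by
    rw [eval_eq_sum_range' (Nat.lt_succ_of_le hr), Finset.mul_sum]
    refine Finset.sum_congr rfl fun i hi => ?_
    have hi : i ≤ d := by simpa [Nat.lt_succ_iff] using hi
    have : v ^ d = v ^ (d - i) * v ^ i := by rw [← pow_add]; congr 1; omega
    rw [this, div_pow]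
    field_simp
  have hH0 (r : ℂ[X]) (u : ℂ) : H r u 0 = r.coeff d * u ^ d := by
    simp only [H]
    rw [Finset.sum_range_succ, Finset.sum_eq_zero]
    · simp
    · intro i hi
      have : d - i ≠ 0 := by have := Finset.mem_range.1 hi; omega
      simp [this]
  have hHne (u v : ℂ) (h1 : H p u v = 0) (h2 : H q u v = 0) : u = 0 ∧ v = 0 := by
    by_cases hv : v = 0
    · subst hv
      rw [hH0] at h1 h2
      refine ⟨?_, rfl⟩
      by_contra hu
      have := pow_ne_zero d hu
      exact hlead.elim (fun h => mul_ne_zero h this h1) (fun h => mul_ne_zero h this h2)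
    · rw [hH p hp u v hv] at h1
      rw [hH q hq u v hv] at h2
      have := pow_ne_zero d hv
      exact ((hroot (u / v)).elim (mul_ne_zero this · h1) (mul_ne_zero this · h2)).elim
  have hP (r : ℂ[X]) (y : ℂ) : (P r).eval y = H r (p.eval y) (q.eval y) := by
    simp [P, H, eval_finsetSum, mul_assoc]
  have hPc (r : ℂ[X]) : (P r).coeff (d * d) = H r (p.coeff d) (q.coeff d) := by
    simp only [P, H, finsetSum_coeff, coeff_C_mul]
    refine Finset.sum_congr rfl fun i hi => ?_
    have hi : i ≤ d := by simpa [Nat.lt_succ_iff] using hi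
    have e : d * d = i * d + (d - i) * d := by rw [← add_mul]; congr 1; omega
    rw [e, coeff_mul_add_eq_of_natDegree_le (natDegree_pow_le_of_le i hp)
      (natDegree_pow_le_of_le _ hq), coeff_pow_of_natDegree_le hp, coeff_pow_of_natDegree_le hq,
      mul_assoc]
  clear_value H P
  by_contra hinf
  have hXP : X * P q - P p = 0 := by
    refine eq_zero_of_infinite_isRoot _ (Set.Infinite.mono ?_ hinf)
    rintro y ⟨x, hx, hy⟩
    have hqy : q.eval y ≠ 0 := by
      intro h
      rw [h, mul_zero] at hx
      exact (hroot y).elim (· hx.symm) (· h)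
    have hx' : p.eval y / q.eval y = x := by rw [← hx]; field_simp
    change IsRoot _ y
    simp only [IsRoot.def, eval_sub, eval_mul, eval_X, hP]
    rw [hH p hp _ _ hqy, hH q hq _ _ hqy, hx', ← hy]
    ring
  have hXP : P p = X * P q := (sub_eq_zero.1 hXP).symm
  -- A root of `P q` would also be a root of `P p`, although `H p` and `H q` vanish together only at
  -- the origin.
  have hdeg : (P q).degree = 0 := by
    by_contra h
    obtain ⟨y, hy⟩ := IsAlgClosed.exists_root _ h
    have h2 : (P p).eval y = 0 := by rw [hXP]; simp [hy.eq_zero]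
    have h1 := hy.eq_zero
    rw [hP] at h1 h2
    obtain ⟨a, b⟩ := hHne _ _ h2 h1
    rcases hroot y with h | h <;> contradiction
  obtain ⟨c, hc⟩ : ∃ c, P q = C c := ⟨_, eq_C_of_degree_eq_zero hdeg⟩
  have hdd : 4 ≤ d * d := Nat.mul_le_mul hd hd
  -- The coefficients of degree d² are the values at infinity; both vanish since d² > 1, against
  -- `hlead`.
  have h1 : (P q).coeff (d * d) = 0 := by
    rw [hc, coeff_C, if_neg (by omega)]
  have h2 : (P p).coeff (d * d) = 0 := by
    rw [hXP, hc, mul_comm, coeff_C_mul, coeff_X, if_neg (by omega), mul_zero]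
  rw [hPc] at h1 h2
  obtain ⟨a, b⟩ := hHne _ _ h2 h1
  rcases hlead with h | h <;> contradiction

/-! ### Partial fractions -/

/-- The number `f₀ + ∑ i, f i / (y - s i)`. -/
noncomputable def partialFractions {ι : Type*} [Fintype ι] (s f : ι → ℂ) (f₀ y : ℂ) : ℂ :=
  f₀ + ∑ i, f i / (y - s i)

open Polynomial in
-- Poles may be repeated in the family, so the common denominator runs over distinct poles and the
-- residues of equal poles add up. The leading coefficient and the values at the poles are what
-- excludes common zeros of two such numerators.
theorem exists_numerator {ι : Type*} [Fintype ι] (s f : ι → ℂ) (f₀ : ℂ) :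
    ∃ p : ℂ[X], p.natDegree ≤ (Finset.univ.image s).card ∧
      p.coeff (Finset.univ.image s).card = f₀ ∧
      (∀ y, (∀ i, y ≠ s i) → p.eval y =
        partialFractions s f f₀ y * ∏ t ∈ Finset.univ.image s, (y - t)) ∧
      ∀ i, p.eval (s i) = (∑ j, if s j = s i then f j else 0) *
        ∏ t ∈ (Finset.univ.image s).erase (s i), (s i - t) := by
  set S := Finset.univ.image s with hS
  let r (t : ℂ) : ℂ := ∑ j, if s j = t then f j else 0
  let N : ℂ[X] := ∏ t ∈ S, (X - C t)
  let M (t : ℂ) : ℂ[X] := ∏ u ∈ S.erase t, (X - C u)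
  have hN : N.Monic := monic_prod_of_monic _ _ fun t _ => monic_X_sub_C t
  have hNd : N.natDegree = S.card := by simp [N]
  have hMd (t : ℂ) (ht : t ∈ S) : (C (r t) * M t).degree < S.card := by
    refine lt_of_le_of_lt degree_le_natDegree (Nat.cast_lt.2 ?_)
    refine lt_of_le_of_lt (natDegree_C_mul_le _ _) ?_
    have : (M t).natDegree = (S.erase t).card := by simp [M]
    rw [this]
    exact Finset.card_erase_lt_of_mem ht
  have hsum : (∑ t ∈ S, C (r t) * M t).degree < S.card := by
    refine (degree_sum_le _ _).trans_lt ?_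
    rw [Finset.sup_lt_iff (WithBot.bot_lt_coe _)]
    exact hMd
  refine ⟨C f₀ * N + ∑ t ∈ S, C (r t) * M t, ?_, ?_, ?_, ?_⟩
  · refine natDegree_add_le_of_degree_le ?_ (natDegree_le_of_degree_le hsum.le)
    exact (natDegree_C_mul_le _ _).trans hNd.le
  · rw [coeff_add, coeff_eq_zero_of_degree_lt hsum, coeff_C_mul, ← hNd, hN.coeff_natDegree]
    simp
  · intro y hy
    have hy' (t : ℂ) (ht : t ∈ S) : y - t ≠ 0 := by
      obtain ⟨i, -, rfl⟩ := Finset.mem_image.1 ht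
      exact sub_ne_zero.2 (hy i)
    have e1 : ∑ i, f i / (y - s i) = ∑ t ∈ S, r t / (y - t) := by
      simp only [r, Finset.sum_div]
      rw [Finset.sum_comm]
      refine Finset.sum_congr rfl fun i _ => ?_
      rw [Finset.sum_eq_single_of_mem (s i) (by simp [hS])]
      · simp
      · intro t _ ht
        simp [ht.symm]
    rw [partialFractions, e1, add_mul, Finset.sum_mul, eval_add, eval_finsetSum]
    congr 1
    · simp [N, eval_prod]
    · refine Finset.sum_congr rfl fun t ht => ?_
      rw [← Finset.mul_prod_erase S _ ht]
      have := hy' t ht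
      simp only [M, eval_mul, eval_C, eval_prod, eval_sub, eval_X]
      field_simp
  · intro i
    have hi : s i ∈ S := by simp [hS]
    rw [eval_add, eval_finsetSum, Finset.sum_eq_single_of_mem (s i) hi]
    · have : N.eval (s i) = 0 := by
        simp only [N, eval_prod]
        exact Finset.prod_eq_zero hi (by simp)
      simp [this, M, eval_prod]
      exact Or.inl rfl
    · intro t _ ht
      have : (M t).eval (s i) = 0 := by
        simp only [M, eval_prod]
        exact Finset.prod_eq_zero (Finset.mem_erase.2 ⟨ht.symm, hi⟩) (by simp)
      simp [this]

/-- The ratio of two partial fraction expansions with at least two poles and without common zeros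
has only finitely many points of period two. -/
theorem finite_two_cycles_partialFractions {ι : Type*} [Fintype ι] (s f g : ι → ℂ) (f₀ g₀ : ℂ)
    (hs : ∃ i j, s i ≠ s j) (h₀ : g₀ ≠ 0 ∨ f₀ ≠ 0)
    (hres : ∀ i, (∑ j, if s j = s i then g j else 0) ≠ 0 ∨
      (∑ j, if s j = s i then f j else 0) ≠ 0)
    (hzero : ∀ y, (∀ i, y ≠ s i) → partialFractions s g g₀ y ≠ 0 ∨ partialFractions s f f₀ y ≠ 0) :
    {y : ℂ | (∀ i, y ≠ s i) ∧ ∃ x, (∀ i, x ≠ s i) ∧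
      x * partialFractions s f f₀ y = partialFractions s g g₀ y ∧
      y * partialFractions s f f₀ x = partialFractions s g g₀ x}.Finite := by
  obtain ⟨p, hp, hpc, hpe, hps⟩ := exists_numerator s g g₀
  obtain ⟨q, hq, hqc, hqe, hqs⟩ := exists_numerator s f f₀
  have hd : 2 ≤ (Finset.univ.image s).card := by
    obtain ⟨i, j, hij⟩ := hs
    exact Finset.one_lt_card.2 ⟨s i, by simp, s j, by simp, hij⟩
  refine (Polynomial.finite_two_cycles hd hp hq (by rwa [hpc, hqc]) ?_).subset ?_
  · intro y
    by_cases hy : ∀ i, y ≠ s i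
    · rw [hpe y hy, hqe y hy]
      have : ∏ t ∈ Finset.univ.image s, (y - t) ≠ 0 := by
        refine Finset.prod_ne_zero_iff.2 fun t ht => ?_
        obtain ⟨i, -, rfl⟩ := Finset.mem_image.1 ht
        exact sub_ne_zero.2 (hy i)
      exact (hzero y hy).imp (mul_ne_zero · this) (mul_ne_zero · this)
    · push Not at hy
      obtain ⟨i, rfl⟩ := hy
      rw [hps, hqs]
      have : ∏ t ∈ (Finset.univ.image s).erase (s i), (s i - t) ≠ 0 :=
        Finset.prod_ne_zero_iff.2 fun t ht => sub_ne_zero.2 (Finset.ne_of_mem_erase ht).symm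
      exact (hres i).imp (mul_ne_zero · this) (mul_ne_zero · this)
  · rintro y ⟨hy, x, hx, h1, h2⟩
    refine ⟨x, ?_, ?_⟩
    · rw [hpe y hy, hqe y hy, ← h1]; ring
    · rw [hpe x hx, hqe x hx, ← h2]; ring

/-! ### The rational map on shape ratios -/

namespace FourVortex

/-- The ratios `w₁₃ / w₁₂` of the collisions `13`, `23`, `14`, `24`, `34` among the configurations
with vanishing first moment; `b`, `c`, `d` are the vorticities of the vortices `2`, `3`, `4`. -/
noncomputable def poles (b c d : ℝ) : Fin 5 → ℂ :=
  ![0, 1, -b / c, -(b + d) / c, -b / (c + d)]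

/-- `w₁₂` times the velocity of vortex `2` relative to vortex `1`, as a function of the ratio
`w₁₃ / w₁₂`. -/
noncomputable def relVelocity₂ (b c d : ℝ) (y : ℂ) : ℂ :=
  partialFractions (poles b c d) ![(c : ℂ), -c, -d ^ 2 / c, d ^ 2 / c, 0] (-(c + d)) y

/-- `w₁₂` times the velocity of vortex `3` relative to vortex `1`, as a function of the ratio
`w₁₃ / w₁₂`. -/
noncomputable def relVelocity₃ (b c d : ℝ) (y : ℂ) : ℂ :=
  partialFractions (poles b c d) ![-(b + d : ℂ), b, -d ^ 2 / c, 0, d ^ 2 / (c + d)]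
    (b + if c + d = 0 then (d : ℂ) ^ 2 / b else 0) y

theorem ne_poles_iff {b c d : ℝ} (hb : b ≠ 0) (hc : c ≠ 0) (hd : d ≠ 0) {y x : ℂ}
    (hx : b + c * y + d * x = 0) :
    (∀ i, y ≠ poles b c d i) ↔ y ≠ 0 ∧ y - 1 ≠ 0 ∧ x ≠ 0 ∧ x - 1 ≠ 0 ∧ x - y ≠ 0 := by
  have hb' : (b : ℂ) ≠ 0 := mod_cast hb
  have hc' : (c : ℂ) ≠ 0 := mod_cast hc
  have hd' : (d : ℂ) ≠ 0 := mod_cast hd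
  obtain rfl : x = -(b + c * y) / d := by field_simp; linear_combination hx
  simp only [Fin.forall_fin_succ, poles, sub_ne_zero]
  simp only [Matrix.cons_val_zero, Matrix.cons_val_succ, IsEmpty.forall_iff, and_true]
  refine and_congr_right fun hy => and_congr Iff.rfl (and_congr ?_ (and_congr ?_ ?_)) <;>
    refine not_congr ?_
  · rw [eq_div_iff hc', div_eq_iff hd']
    constructor <;> intro h <;> linear_combination -h
  · rw [eq_div_iff hc', div_eq_iff hd']
    constructor <;> intro h <;> linear_combination -h
  -- If c + d = 0, the fifth pole takes the default value 0, already excluded, while x = y would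
  -- force b = 0.
  · by_cases hcd : (c + d : ℂ) = 0
    · rw [hcd, div_zero, div_eq_iff hd']
      refine iff_of_false hy fun h => hb' ?_
      linear_combination -h - y * hcd
    · rw [eq_div_iff hcd, div_eq_iff hd']
      constructor <;> intro h <;> linear_combination -h

theorem relVelocity₂_eq {b c d : ℝ} (hb : b ≠ 0) (hc : c ≠ 0) (hd : d ≠ 0) {y x : ℂ}
    (hx : b + c * y + d * x = 0) (h : ∀ i, y ≠ poles b c d i) :
    relVelocity₂ b c d y = -(c + d) + c / y - c / (y - 1) + d / x - d / (x - 1) := by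
  have hc' : (c : ℂ) ≠ 0 := mod_cast hc
  have hd' : (d : ℂ) ≠ 0 := mod_cast hd
  obtain ⟨h1, h2, h3, h4, h5⟩ := (ne_poles_iff hb hc hd hx).1 h
  have e1 : y - -b / c = - d / c * x := by field_simp; linear_combination hx
  have e2 : y - -(b + d) / c = - d / c * (x - 1) := by field_simp; linear_combination hx
  simp only [relVelocity₂, partialFractions, Fin.sum_univ_five, poles]
  simp only [Matrix.cons_val, e1, e2]
  field_simp
  ring

theorem relVelocity₃_eq {b c d : ℝ} (hb : b ≠ 0) (hc : c ≠ 0) (hd : d ≠ 0) {y x : ℂ}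
    (hx : b + c * y + d * x = 0) (h : ∀ i, y ≠ poles b c d i) :
    relVelocity₃ b c d y = b - (b + d) / y + b / (y - 1) + d / x - d / (x - y) := by
  have hb' : (b : ℂ) ≠ 0 := mod_cast hb
  have hc' : (c : ℂ) ≠ 0 := mod_cast hc
  have hd' : (d : ℂ) ≠ 0 := mod_cast hd
  obtain ⟨h1, h2, h3, h4, h5⟩ := (ne_poles_iff hb hc hd hx).1 h
  have e1 : y - -b / c = - d / c * x := by field_simp; linear_combination hx
  simp only [relVelocity₃, partialFractions, Fin.sum_univ_five, poles]
  simp only [Matrix.cons_val, e1]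
  -- If c + d = 0, then x - y = -b/d is constant: the collision 34 moves to infinity and its term
  -- joins the constant as d²/b.
  by_cases hcd : c + d = 0
  · have hcd' : (c + d : ℂ) = 0 := mod_cast hcd
    have e2 : x - y = - b / d := by
      field_simp
      linear_combination hx - y * hcd'
    simp only [hcd, hcd', e2, if_true]
    field_simp
    ring
  · have hcd' : (c + d : ℂ) ≠ 0 := mod_cast hcd
    have e2 : y - -b / (c + d) = - d / (c + d) * (x - y) := by
      field_simp; linear_combination hx
    simp only [hcd, e2, if_false]
    field_simp
    ring

/-- With Γ₁ = -(b + c + d), this is the sum of ΓⱼΓₖ over pairs, which equals -½ ∑ Γₙ² and is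
negative for real vorticities. -/
theorem sum_pairs_ne_zero {b c d : ℝ} (hb : b ≠ 0) :
    (b * c + b * d + c * d - (b + c + d) ^ 2 : ℂ) ≠ 0 := by
  have : b * c + b * d + c * d - (b + c + d) ^ 2 ≠ 0 := by
    have := sq_pos_of_ne_zero hb
    nlinarith [sq_nonneg (b + c + d), sq_nonneg c, sq_nonneg d]
  exact mod_cast this

/-- The virial identity: ∑ Γₙ wₙ times the velocity of n equals the sum of ΓⱼΓₖ over pairs, so the
relative velocities cannot all vanish. Vanishing moment of the velocities supplies that of vortex 4.
-/
theorem relVelocity_ne_zero {b c d : ℝ} (hb : b ≠ 0) (hc : c ≠ 0) (hd : d ≠ 0) {y : ℂ}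
    (h : ∀ i, y ≠ poles b c d i) : relVelocity₃ b c d y ≠ 0 ∨ relVelocity₂ b c d y ≠ 0 := by
  have hd' : (d : ℂ) ≠ 0 := mod_cast hd
  obtain ⟨x, hx⟩ : ∃ x : ℂ, b + c * y + d * x = 0 := ⟨-(b + c * y) / d, by field_simp; ring⟩
  obtain ⟨h1, h2, h3, h4, h5⟩ := (ne_poles_iff hb hc hd hx).1 h
  rw [relVelocity₂_eq hb hc hd hx h, relVelocity₃_eq hb hc hd hx h]
  by_contra! hcon
  obtain ⟨hG, hF⟩ := hcon
  refine sum_pairs_ne_zero (c := c) (d := d) hb ?_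
  have key : b * (-(c + d) + c / y - c / (y - 1) + d / x - d / (x - 1))
      + c * y * (b - (b + d) / y + b / (y - 1) + d / x - d / (x - y))
      - x * (b * (-(c + d) + c / y - c / (y - 1) + d / x - d / (x - 1))
      + c * (b - (b + d) / y + b / (y - 1) + d / x - d / (x - y)))
      = (b * c + b * d + c * d - (b + c + d) ^ 2 : ℂ) := by
    obtain hb' : (b : ℂ) = - (c * y + d * x) := by linear_combination hx
    rw [hb']
    field_simp
    ring
  rw [← key, hF, hG]
  ring

/-- When two poles of `relVelocity₂` coincide, their residues c and d²/c have the same sign and add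
to ±(c² + d²)/c, nonzero for real vorticities. The pole 34 is seen only by `relVelocity₃`, unless c
+ d = 0 sends its index to the pole 0. -/
theorem residues_ne_zero {b c d : ℝ} (hb : b ≠ 0) (hc : c ≠ 0) (hd : d ≠ 0) (ha : b + c + d ≠ 0)
    (i : Fin 5) :
    (∑ j, if poles b c d j = poles b c d i then
      ![-(b + d : ℂ), b, -d ^ 2 / c, 0, d ^ 2 / (c + d)] j else 0) ≠ 0 ∨
    (∑ j, if poles b c d j = poles b c d i then
      ![(c : ℂ), -c, -d ^ 2 / c, d ^ 2 / c, 0] j else 0) ≠ 0 := by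
  have hb' : (b : ℂ) ≠ 0 := mod_cast hb
  have hc' : (c : ℂ) ≠ 0 := mod_cast hc
  have hd' : (d : ℂ) ≠ 0 := mod_cast hd
  have hcd2 : (c : ℂ) ^ 2 + d ^ 2 ≠ 0 := by
    have : c ^ 2 + d ^ 2 ≠ 0 := by positivity
    exact mod_cast this
  have ha' : (b + c + d : ℂ) ≠ 0 := mod_cast ha
  have hplus : (c : ℂ) + d ^ 2 / c ≠ 0 := by
    have : (c : ℂ) + d ^ 2 / c = (c ^ 2 + d ^ 2) / c := by field_simp
    rw [this]
    exact div_ne_zero hcd2 hc'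
  have hminus : -(c : ℂ) + -d ^ 2 / c ≠ 0 := by
    have : -(c : ℂ) + -d ^ 2 / c = -(c + d ^ 2 / c) := by ring
    rw [this]
    exact neg_ne_zero.2 hplus
  have hdc : (d : ℂ) ^ 2 / c ≠ 0 := div_ne_zero (pow_ne_zero 2 hd') hc'
  have hdc' : -(d : ℂ) ^ 2 / c ≠ 0 := by rw [neg_div]; exact neg_ne_zero.2 hdc
  have n02 : (-b / c : ℂ) ≠ 0 := div_ne_zero (neg_ne_zero.2 hb') hc'
  have n13 : (-(b + d) / c : ℂ) ≠ 1 := by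
    rw [Ne, div_eq_iff hc']
    exact fun h => ha' (by linear_combination -h)
  have n23 : (-b / c : ℂ) ≠ -(b + d) / c := by
    rw [Ne, div_left_inj' hc']
    exact fun h => hd' (by linear_combination h)
  have p0 : poles b c d 0 = 0 := rfl
  have p1 : poles b c d 1 = 1 := rfl
  have p2 : poles b c d 2 = -b / c := rfl
  have p3 : poles b c d 3 = -(b + d) / c := rfl
  have p4 : poles b c d 4 = -b / (c + d) := rfl
  have ite_cases (p : Prop) [Decidable p] (u : ℂ) :
      (if p then u else 0) = u ∨ (if p then u else 0) = 0 := by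
    by_cases hp : p <;> simp [hp]
  have r0 : (∑ j, if poles b c d j = 0 then
      ![(c : ℂ), -c, -d ^ 2 / c, d ^ 2 / c, 0] j else 0) ≠ 0 := by
    simp only [p0, p1, p2, p3, p4, Fin.sum_univ_five, Matrix.cons_val, n02, if_true, if_false,
      one_ne_zero]
    rcases ite_cases (-(b + d : ℂ) / c = 0) (d ^ 2 / c) with h | h <;>
    rcases ite_cases (-(b : ℂ) / (c + d) = 0) 0 with h' | h' <;>
    rw [h, h'] <;> simp only [add_zero] <;> assumption
  fin_cases i
  · exact Or.inr r0
  · right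
    change (∑ j, if poles b c d j = 1 then _ else _) ≠ 0
    simp only [p0, p1, p2, p3, p4, Fin.sum_univ_five, Matrix.cons_val, n13, if_true, if_false,
      zero_ne_one]
    rcases ite_cases (-(b : ℂ) / c = 1) (-d ^ 2 / c) with h | h <;>
    rcases ite_cases (-(b : ℂ) / (c + d) = 1) 0 with h' | h' <;>
    rw [h, h'] <;> simp only [add_zero, zero_add] <;> first | exact hminus | exact neg_ne_zero.2 hc'
  · right
    change (∑ j, if poles b c d j = -b / c then _ else _) ≠ 0
    simp only [p0, p1, p2, p3, p4, Fin.sum_univ_five, Matrix.cons_val, n02.symm, n23.symm,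
      if_true, if_false]
    rcases ite_cases (1 = -(b : ℂ) / c) (-c) with h | h <;>
    rcases ite_cases (-(b : ℂ) / (c + d) = -b / c) 0 with h' | h' <;>
    rw [h, h'] <;> simp only [add_zero, zero_add] <;> assumption
  · right
    change (∑ j, if poles b c d j = -(b + d) / c then _ else _) ≠ 0
    simp only [p0, p1, p2, p3, p4, Fin.sum_univ_five, Matrix.cons_val, n13.symm, n23,
      if_true, if_false]
    rcases ite_cases (0 = -(b + d : ℂ) / c) c with h | h <;>
    rcases ite_cases (-(b : ℂ) / (c + d) = -(b + d) / c) 0 with h' | h' <;>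
    rw [h, h'] <;> simp only [add_zero, zero_add] <;> assumption
  · change (∑ j, if poles b c d j = -b / (c + d) then _ else _) ≠ 0 ∨
      (∑ j, if poles b c d j = -b / (c + d) then _ else _) ≠ 0
    by_cases hcd : (c + d : ℂ) = 0
    · right
      rw [hcd, div_zero]
      exact r0
    · left
      have n0 : (0 : ℂ) ≠ -b / (c + d) := (div_ne_zero (neg_ne_zero.2 hb') hcd).symm
      have n1 : (1 : ℂ) ≠ -b / (c + d) := by
        rw [Ne, eq_div_iff hcd]
        exact fun h => ha' (by linear_combination h)
      have n2 : (-b / c : ℂ) ≠ -b / (c + d) := by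
        rw [Ne, div_eq_div_iff hc' hcd]
        exact fun h => mul_ne_zero hb' hd' (by linear_combination -h)
      simp only [p0, p1, p2, p3, p4, Fin.sum_univ_five, Matrix.cons_val, n0, n1, n2,
        if_true, if_false]
      rcases ite_cases (-(b + d : ℂ) / c = -b / (c + d)) 0 with h | h <;>
      rw [h] <;> simp only [zero_add] <;> exact div_ne_zero (pow_ne_zero 2 hd') hcd

/-- The set of ratios `w₁₃ / w₁₂` of the central configurations. -/
theorem finite_ratios {b c d : ℝ} (hb : b ≠ 0) (hc : c ≠ 0) (hd : d ≠ 0) (ha : b + c + d ≠ 0) :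
    {y : ℂ | (∀ i, y ≠ poles b c d i) ∧ ∃ x, (∀ i, x ≠ poles b c d i) ∧
      x * relVelocity₂ b c d y = relVelocity₃ b c d y ∧
      y * relVelocity₂ b c d x = relVelocity₃ b c d x}.Finite := by
  refine finite_two_cycles_partialFractions _ _ _ _ _ ⟨0, 1, by simp [poles]⟩ ?_
    (residues_ne_zero hb hc hd ha) fun y hy => relVelocity_ne_zero hb hc hd hy
  by_cases hcd : c + d = 0
  · left
    have h : b + d ^ 2 / b ≠ 0 := by
      have : b + d ^ 2 / b = (b ^ 2 + d ^ 2) / b := by field_simp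
      rw [this]
      positivity
    rw [if_pos hcd]
    exact mod_cast h
  · right
    exact neg_ne_zero.2 (mod_cast hcd)

end FourVortex

/-! ### From central configurations to two-cycles -/

namespace FourVortex

theorem ext_symm (Z : Pair → ℂ) (j k : Fin 4) : ext Z k j = -ext Z j k := by
  unfold ext
  rcases lt_trichotomy j k with h | h | h
  · simp [h, h.not_gt]
  · simp [h]
  · simp [h, h.not_gt]

theorem ext_eq_inv {Z : Pair → ℂ} {w : Fin 4 → ℂ}
    (h : ∀ j k, j < k → ext Z j k * sep w j k = 1) {j k : Fin 4} (hjk : j ≠ k) :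
    ext Z j k = (w k - w j)⁻¹ := by
  rcases hjk.lt_or_gt with hlt | hlt
  · exact eq_inv_of_mul_eq_one_left (h j k hlt)
  · refine eq_inv_of_mul_eq_one_left ?_
    rw [ext_symm, ← h k j hlt, sep]
    ring

theorem injective_of_ext_mul_sep {Z : Pair → ℂ} {w : Fin 4 → ℂ}
    (h : ∀ j k, j < k → ext Z j k * sep w j k = 1) : Function.Injective w := by
  intro j k hjk
  by_contra hne
  rcases lt_or_gt_of_ne hne with hlt | hlt
  · simpa [sep, hjk] using h j k hlt
  · simpa [sep, hjk] using h k j hlt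

/-- The equations for the positions `z` in terms of the positions `w`. -/
def HalfEq (Γ : Fin 4 → ℝ) (c : ℂ) (z w : Fin 4 → ℂ) : Prop :=
  ∀ n, c * z n = ∑ j, (Γ j : ℂ) * (w n - w j)⁻¹

theorem halfEq_of_ext {Γ : Fin 4 → ℝ} {c : ℂ} {Z : Pair → ℂ} {z w : Fin 4 → ℂ}
    (h : ∀ j k, j < k → ext Z j k * sep w j k = 1)
    (hz : ∀ n, c * z n = ∑ j ∈ Finset.univ.erase n, (Γ j : ℂ) * ext Z j n) : HalfEq Γ c z w := by
  intro n
  -- The term j = n may be included because 0⁻¹ = 0.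
  rw [hz, ← Finset.sum_erase Finset.univ (a := n) (by simp)]
  refine Finset.sum_congr rfl fun j hj => ?_
  rw [ext_eq_inv h (Finset.ne_of_mem_erase hj)]

/-- Weighted by Γₙ, the interactions form an antisymmetric double sum. -/
theorem HalfEq.sum_eq_zero {Γ : Fin 4 → ℝ} {c : ℂ} {z w : Fin 4 → ℂ} (h : HalfEq Γ c z w)
    (hc : c ≠ 0) : ∑ n, (Γ n : ℂ) * z n = 0 := by
  have h1 : c * ∑ n, (Γ n : ℂ) * z n = ∑ n, ∑ j, (Γ n : ℂ) * Γ j * (w n - w j)⁻¹ := by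
    rw [Finset.mul_sum]
    refine Finset.sum_congr rfl fun n _ => ?_
    rw [mul_left_comm, h n, Finset.mul_sum]
    exact Finset.sum_congr rfl fun j _ => by ring
  have h2 : (∑ n, ∑ j, (Γ n : ℂ) * Γ j * (w n - w j)⁻¹) =
      -∑ n, ∑ j, (Γ n : ℂ) * Γ j * (w n - w j)⁻¹ := by
    conv_lhs => rw [Finset.sum_comm]
    rw [← Finset.sum_neg_distrib]
    refine Finset.sum_congr rfl fun n _ => ?_
    rw [← Finset.sum_neg_distrib]
    refine Finset.sum_congr rfl fun j _ => ?_
    rw [← neg_sub (w n), inv_neg]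
    ring
  have h3 : c * ∑ n, (Γ n : ℂ) * z n = 0 := by
    rw [h1]
    exact self_eq_neg.1 h2
  exact (mul_eq_zero.1 h3).resolve_left hc

theorem HalfEq.relVelocity {Γ : Fin 4 → ℝ} {c : ℂ} {z w : Fin 4 → ℂ} (h : HalfEq Γ c z w)
    (hΓ : ∀ n, Γ n ≠ 0) (hsum : ∑ n, Γ n = 0) (hw : Function.Injective w)
    (hw0 : ∑ n, (Γ n : ℂ) * w n = 0) :
    (∀ i, (w 2 - w 0) / (w 1 - w 0) ≠ poles (Γ 1) (Γ 2) (Γ 3) i) ∧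
    relVelocity₂ (Γ 1) (Γ 2) (Γ 3) ((w 2 - w 0) / (w 1 - w 0)) =
      c * ((w 1 - w 0) * (z 1 - z 0)) ∧
    relVelocity₃ (Γ 1) (Γ 2) (Γ 3) ((w 2 - w 0) / (w 1 - w 0)) =
      c * ((w 1 - w 0) * (z 2 - z 0)) := by
  have hs : (Γ 0 : ℂ) + Γ 1 + Γ 2 + Γ 3 = 0 := by
    rw [Fin.sum_univ_four] at hsum
    exact mod_cast hsum
  have hs0 : (Γ 0 : ℂ) = -(Γ 1 + Γ 2 + Γ 3) := by linear_combination hs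
  rw [Fin.sum_univ_four] at hw0
  have ne (i j : Fin 4) (hij : i ≠ j) : w i - w j ≠ 0 := sub_ne_zero.2 (hw.ne hij)
  have h10 := ne 1 0 (by decide)
  have h20 := ne 2 0 (by decide)
  have h30 := ne 3 0 (by decide)
  have h21 := ne 2 1 (by decide)
  have h31 := ne 3 1 (by decide)
  have h32 := ne 3 2 (by decide)
  have hx : (Γ 1 : ℂ) + Γ 2 * ((w 2 - w 0) / (w 1 - w 0)) + Γ 3 * ((w 3 - w 0) / (w 1 - w 0))
      = 0 := by
    field_simp
    linear_combination hw0 - w 0 * hs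
  have ey : (w 2 - w 0) / (w 1 - w 0) - 1 = (w 2 - w 1) / (w 1 - w 0) := by field_simp; ring
  have ex : (w 3 - w 0) / (w 1 - w 0) - 1 = (w 3 - w 1) / (w 1 - w 0) := by field_simp; ring
  have exy : (w 3 - w 0) / (w 1 - w 0) - (w 2 - w 0) / (w 1 - w 0) =
      (w 3 - w 2) / (w 1 - w 0) := by field_simp; ring
  have hy := (ne_poles_iff (hΓ 1) (hΓ 2) (hΓ 3) hx).2 (by
    rw [ey, ex, exy]
    exact ⟨div_ne_zero h20 h10, div_ne_zero h21 h10, div_ne_zero h30 h10, div_ne_zero h31 h10,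
      div_ne_zero h32 h10⟩)
  have z0 := h 0
  have z1 := h 1
  have z2 := h 2
  rw [Fin.sum_univ_four, sub_self, inv_zero, mul_zero] at z0 z1 z2
  rw [← neg_sub (w 1), ← neg_sub (w 2), ← neg_sub (w 3)] at z0
  rw [← neg_sub (w 2), ← neg_sub (w 3)] at z1
  rw [← neg_sub (w 3)] at z2
  simp only [inv_neg] at z0 z1 z2
  refine ⟨hy, ?_, ?_⟩
  · rw [relVelocity₂_eq (hΓ 1) (hΓ 2) (hΓ 3) hx hy, ey, ex]
    have : c * ((w 1 - w 0) * (z 1 - z 0)) = (w 1 - w 0) * (c * z 1 - c * z 0) := by ring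
    rw [this, z1, z0, hs0]
    simp only [div_div_eq_mul_div]
    simp only [div_eq_mul_inv]
    linear_combination ((Γ 2 : ℂ) + Γ 3) * mul_inv_cancel₀ h10
  · rw [relVelocity₃_eq (hΓ 1) (hΓ 2) (hΓ 3) hx hy, ey, exy]
    have : c * ((w 1 - w 0) * (z 2 - z 0)) = (w 1 - w 0) * (c * z 2 - c * z 0) := by ring
    rw [this, z2, z0, hs0]
    simp only [div_div_eq_mul_div]
    simp only [div_eq_mul_inv]
    linear_combination (-(Γ 1 : ℂ)) * mul_inv_cancel₀ h10

/-- Positions with vanishing first moment are determined up to translation by two differences. -/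
theorem sub_eq_sub {Γ : Fin 4 → ℝ} (hΓ : ∀ n, Γ n ≠ 0) (hsum : ∑ n, Γ n = 0) {z z' : Fin 4 → ℂ}
    (h : ∑ n, (Γ n : ℂ) * z n = 0) (h' : ∑ n, (Γ n : ℂ) * z' n = 0)
    (h1 : z 1 - z 0 = z' 1 - z' 0) (h2 : z 2 - z 0 = z' 2 - z' 0) (j k : Fin 4) :
    z k - z j = z' k - z' j := by
  have hs : (Γ 0 : ℂ) + Γ 1 + Γ 2 + Γ 3 = 0 := by
    rw [Fin.sum_univ_four] at hsum
    exact mod_cast hsum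
  rw [Fin.sum_univ_four] at h h'
  have h3 : z 3 - z 0 = z' 3 - z' 0 := by
    have : (Γ 3 : ℂ) ≠ 0 := mod_cast hΓ 3
    refine mul_left_cancel₀ this ?_
    linear_combination h - h' - Γ 1 * h1 - Γ 2 * h2 - (z 0 - z' 0) * hs
  have key (n : Fin 4) : z n - z 0 = z' n - z' 0 := by
    fin_cases n
    · simp
    · exact h1
    · exact h2
    · exact h3
  linear_combination key k - key j

/-- The right-hand sides see only differences of `w`, while the left-hand sides are positions; this
fixes the translation. -/
theorem HalfEq.unique {Γ : Fin 4 → ℝ} {c : ℂ} {z w z' w' : Fin 4 → ℂ} (hc : c ≠ 0)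
    (h : HalfEq Γ c z w) (h' : HalfEq Γ c z' w') (hw : ∀ j k, w k - w j = w' k - w' j) :
    z = z' := by
  funext n
  refine mul_left_cancel₀ hc ?_
  rw [h n, h' n]
  exact Finset.sum_congr rfl fun j _ => by rw [hw j n]

theorem eq_of_ext_mul_sep {Z Z' : Pair → ℂ} {w w' : Fin 4 → ℂ}
    (h : ∀ j k, j < k → ext Z j k * sep w j k = 1)
    (h' : ∀ j k, j < k → ext Z' j k * sep w' j k = 1) (hw : w = w') : Z = Z' := by
  funext p
  have e := ext_eq_inv h p.2.ne
  have e' := ext_eq_inv h' p.2.ne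
  rw [← hw, ← e] at e'
  simpa [ext, p.2] using e'.symm

theorem IsSolution.unique {Γ : Fin 4 → ℝ} (hΓ : ∀ n, Γ n ≠ 0) (hsum : ∑ n, Γ n = 0) {Λ : ℂ}
    (hΛ : Λ ≠ 0) {Q Q' : Space} (h : IsSolution Γ Λ Q) (h' : IsSolution Γ Λ Q')
    (h1 : sep Q.1.1 0 1 = sep Q'.1.1 0 1) (h2 : sep Q.1.1 0 2 = sep Q'.1.1 0 2)
    (h3 : sep Q.2.1 0 2 = sep Q'.2.1 0 2) : Q = Q' := by
  have hz := halfEq_of_ext h.Z_mul h.z_eq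
  have hw := halfEq_of_ext h.W_mul h.w_eq
  have hz' := halfEq_of_ext h'.Z_mul h'.z_eq
  have hw' := halfEq_of_ext h'.W_mul h'.w_eq
  have hΛ' := inv_ne_zero hΛ
  have ez := hz.unique hΛ hz' (sub_eq_sub hΓ hsum (hw.sum_eq_zero hΛ') (hw'.sum_eq_zero hΛ')
    (by have := h.rotation.symm.trans (h1.trans h'.rotation); exact this) h3)
  have ew := hw.unique hΛ' hw' (sub_eq_sub hΓ hsum (hz.sum_eq_zero hΛ) (hz'.sum_eq_zero hΛ) h1 h2)
  exact Prod.ext (Prod.ext ez (eq_of_ext_mul_sep h.Z_mul h'.Z_mul ew))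
    (Prod.ext ew (eq_of_ext_mul_sep h.W_mul h'.W_mul ez))

/-- The two ratios of a central configuration, and the relations between them, the size
`z₁₂ = w₁₂` and the multiplier. -/
theorem IsSolution.ratios {Γ : Fin 4 → ℝ} (hΓ : ∀ n, Γ n ≠ 0) (hsum : ∑ n, Γ n = 0) {Λ : ℂ}
    (hΛ : Λ ≠ 0) {Q : Space} (h : IsSolution Γ Λ Q) :
    ∃ a x y : ℂ, a ≠ 0 ∧ sep Q.1.1 0 1 = a ∧ sep Q.1.1 0 2 = x * a ∧ sep Q.2.1 0 2 = y * a ∧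
      (∀ i, x ≠ poles (Γ 1) (Γ 2) (Γ 3) i) ∧ (∀ i, y ≠ poles (Γ 1) (Γ 2) (Γ 3) i) ∧
      relVelocity₂ (Γ 1) (Γ 2) (Γ 3) y = Λ * a ^ 2 ∧
      relVelocity₂ (Γ 1) (Γ 2) (Γ 3) x = Λ⁻¹ * a ^ 2 ∧
      x * relVelocity₂ (Γ 1) (Γ 2) (Γ 3) y = relVelocity₃ (Γ 1) (Γ 2) (Γ 3) y ∧
      y * relVelocity₂ (Γ 1) (Γ 2) (Γ 3) x = relVelocity₃ (Γ 1) (Γ 2) (Γ 3) x := by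
  have hz := halfEq_of_ext h.Z_mul h.z_eq
  have hw := halfEq_of_ext h.W_mul h.w_eq
  have hzi := injective_of_ext_mul_sep h.W_mul
  have hwi := injective_of_ext_mul_sep h.Z_mul
  obtain ⟨py, fy, gy⟩ := hz.relVelocity hΓ hsum hwi (hw.sum_eq_zero (inv_ne_zero hΛ))
  obtain ⟨px, fx, gx⟩ := hw.relVelocity hΓ hsum hzi (hz.sum_eq_zero hΛ)
  have ha : Q.1.1 1 - Q.1.1 0 ≠ 0 := sub_ne_zero.2 (hzi.ne (by decide))
  have hr : Q.1.1 1 - Q.1.1 0 = Q.2.1 1 - Q.2.1 0 := h.rotation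
  refine ⟨Q.1.1 1 - Q.1.1 0, _, _, ha, rfl, ?_, ?_, px, py, ?_, ?_, ?_, ?_⟩
  · rw [div_mul_cancel₀ _ ha, sep]
  · rw [hr, div_mul_cancel₀ _ (hr ▸ ha), sep]
  · rw [fy, ← hr]; ring
  · rw [fx, ← hr]; ring
  · rw [fy, gy, ← hr]; field_simp
  · rw [fx, gx, ← hr]; field_simp

end FourVortex

/-! ### Finiteness -/

theorem theorem6p3 (Γ : Fin 4 → ℝ) (hΓ : ∀ n, Γ n ≠ 0) (hsum : ∑ n, Γ n = 0) :
    {Q : FourVortex.Space | FourVortex.IsNormalizedCentralConfiguration Γ Q}.Finite := by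
  open FourVortex in
  have ha : Γ 1 + Γ 2 + Γ 3 ≠ 0 := by
    intro h
    rw [Fin.sum_univ_four] at hsum
    exact hΓ 0 (by linarith)
  have hT := finite_ratios (hΓ 1) (hΓ 2) (hΓ 3) ha
  set T := {y : ℂ | (∀ i, y ≠ poles (Γ 1) (Γ 2) (Γ 3) i) ∧ ∃ x,
      (∀ i, x ≠ poles (Γ 1) (Γ 2) (Γ 3) i) ∧
      x * relVelocity₂ (Γ 1) (Γ 2) (Γ 3) y = relVelocity₃ (Γ 1) (Γ 2) (Γ 3) y ∧
      y * relVelocity₂ (Γ 1) (Γ 2) (Γ 3) x = relVelocity₃ (Γ 1) (Γ 2) (Γ 3) x} with hTdef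
  let F := relVelocity₂ (Γ 1) (Γ 2) (Γ 3)
  -- The triple is (a, x, y); the last condition recovers Λ from it.
  let R (t : ℂ × ℂ × ℂ) : Set Space := {Q | ∃ Λ : ℂ, Λ ≠ 0 ∧ IsSolution Γ Λ Q ∧ t.1 ≠ 0 ∧
    sep Q.1.1 0 1 = t.1 ∧ sep Q.1.1 0 2 = t.2.1 * t.1 ∧ sep Q.2.1 0 2 = t.2.2 * t.1 ∧
    F t.2.2 = Λ * t.1 ^ 2}
  have hR (t : ℂ × ℂ × ℂ) : (R t).Finite := by
    refine Set.Subsingleton.finite ?_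
    rintro Q ⟨Λ, hΛ, hQ, ht, h1, h2, h3, h4⟩ Q' ⟨Λ', -, hQ', -, h1', h2', h3', h4'⟩
    obtain rfl : Λ = Λ' := mul_right_cancel₀ (pow_ne_zero 2 ht) (h4.symm.trans h4')
    exact hQ.unique hΓ hsum hΛ hQ' (h1.trans h1'.symm) (h2.trans h2'.symm) (h3.trans h3'.symm)
  have hroots (v : ℂ) : {a : ℂ | a ^ 4 = v}.Finite := by
    refine (Polynomial.nthRoots 4 v).toFinset.finite_toSet.subset fun a h => ?_
    have h : a ^ 4 = v := h
    simpa [Polynomial.mem_nthRoots] using h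
  have hfin : (⋃ y ∈ T, ⋃ x ∈ T, ⋃ a ∈ {a : ℂ | a ^ 4 = F x * F y}, R (a, x, y)).Finite :=
    hT.biUnion fun y _ => hT.biUnion fun x _ => (hroots _).biUnion fun a _ => hR _
  refine hfin.subset ?_
  rintro Q ⟨Λ, hΛ, hQ⟩
  have hΛ0 : Λ ≠ 0 := by
    rintro rfl
    simp at hΛ
  obtain ⟨a, x, y, ha, h1, h2, h3, px, py, fy, fx, ey, ex⟩ := hQ.ratios hΓ hsum hΛ0
  simp only [Set.mem_iUnion]
  refine ⟨y, ⟨py, x, px, ey, ex⟩, x, ⟨px, y, py, ex, ey⟩, a, ?_, Λ, hΛ0, hQ, ha, h1, h2, h3, fy⟩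
  change a ^ 4 = F x * F y
  simp only [F, fx, fy]
  field_simp
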